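/- **Theorem 1.3 (Ratio limit theorem).** Let $G$ be a finitely generated amenable group with identity $e$, and let $\mu : G \to [0,\infty)$, $\sum_{g\in G}\mu(g)=1$, be a probability measure on $G$. Write $\mu^{*n}$ for the $n$-fold convolution power of $\mu$, where $(\mu*\nu)(g)=\sum_{s\in G}\mu(s)\nu(s^{-1}g)$, and $\lambda(G,\mu)=\limsup_{n\to\infty}(\mu^{*n}(e))^{1/n}$. Assume that $\mu$ is non-degenerate (its support $\{g : \mu(g)>0\}$ generates $G$ as a semigroup) and that $(G,\mu)$ is aperiodic (there is $n_0\ge 1$ such that $\mu^{*n}(e)>0$ for all $n\ge n_0$). Identify the quotient of the abelianisation $G/[G,G]$ by its torsion subgroup with $\mathbb Z^k$, where $k \ge 0$ is its rank, let $\pi : G\to\mathbb Z^k$ be the natural projection, and define $\phi_\mu:\mathbb R^k\to[0,\infty]$ by $$\phi_\mu(v)=\sum_{g\in G}e^{\langle v,\pi(g)\rangle}\mu(g), \qquad \langle v,m\rangle=v_1m_1+\dots+v_km_k .$$ Then $\phi_\mu$ attains its minimum at a unique point $\xi\in\mathbb R^k$; this $\xi$ is also the unique point of $\mathbb R^k$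 with $\phi_\mu(\xi)=\lambda(G,\mu)$; for every $g\in G$, $$\lim_{n\to\infty}\frac{\mu^{*n}(g)}{\mu^{*n}(e)}=e^{-\langle\xi,\pi(g)\rangle};$$ and $$\lim_{n\to\infty}\frac{\mu^{*(n+1)}(e)}{\mu^{*n}(e)}=\lambda(G,\mu).$$ Here $G$ is amenable if there is a linear functional $M:\ell^\infty(G)\to\mathbb R$ with $M(1)=1$, $\inf f\le M(f)\le\sup f$ and $M(f_g)=M(f)$ for all $f \in \ell^\infty(G)$ and $g \in G$, where $f_g(x)=f(gx)$. -/

import Mathlib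

open Filter Topology
open scoped ENNReal

namespace RatioLimit

/-- A probability measure on `G`, given as a nonnegative function of total mass one. -/
structure IsProbability {G : Type*} (μ : G → ℝ) : Prop where
  nonneg : ∀ g, 0 ≤ μ g
  hasSum_one : HasSum μ 1

/-- Convolution: `(μ * ν)(g) = ∑ₛ μ(s) ν(s⁻¹ g)`. -/
noncomputable def conv {G : Type*} [Group G] (μ ν : G → ℝ) (g : G) : ℝ :=
  ∑' s : G, μ s * ν (s⁻¹ * g)

/-- The convolution powers `μ^{*n}`, where `μ^{*0}` is the point mass at the identity. -/
noncomputable def convPow {G : Type*} [Group G] (μ : G → ℝ) : ℕ → G → ℝ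
  | 0 => Set.indicator {1} 1
  | n + 1 => conv μ (convPow μ n)

/-- The support of `μ` generates `G` as a semigroup. -/
def IsNondegenerate {G : Type*} [Group G] (μ : G → ℝ) : Prop :=
  Subsemigroup.closure {g : G | 0 < μ g} = ⊤

/-- `μ^{*n}(e) > 0` for all sufficiently large `n`. -/
def IsAperiodic {G : Type*} [Group G] (μ : G → ℝ) : Prop :=
  ∃ n₀ : ℕ, 1 ≤ n₀ ∧ ∀ n, n₀ ≤ n → 0 < convPow μ n 1

/-- The spectral radius `λ(G, μ) = limsup (μ^{*n}(e))^{1/n}`. For a probability measure the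
sequence lies in `[0, 1]`, so the real `limsup` is the genuine one. -/
noncomputable def spectralRadius {G : Type*} [Group G] (μ : G → ℝ) : ℝ :=
  limsup (fun n : ℕ => convPow μ n 1 ^ (1 / (n : ℝ))) atTop

/-- Amenability: there is a Banach mean on `ℓ^∞(G)`, i.e. a linear functional `M` with `M(1) = 1`,
`inf f ≤ M(f) ≤ sup f`, and `M(f_g) = M(f)` where `f_g(x) = f(gx)`. -/
def IsAmenable (G : Type*) [Group G] : Prop :=
  ∃ M : lp (fun _ : G => ℝ) ∞ →ₗ[ℝ] ℝ,
    M 1 = 1 ∧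
    (∀ f : lp (fun _ : G => ℝ) ∞, (⨅ x, f x) ≤ M f ∧ M f ≤ (⨆ x, f x)) ∧
    ∀ (g : G) (f f' : lp (fun _ : G => ℝ) ∞), (∀ x, f' x = f (g * x)) → M f' = M f

/-- The torsion-free part of the abelianisation of `G`. -/
abbrev FreeAb (G : Type*) [Group G] : Type _ :=
  Abelianization G ⧸ CommGroup.torsion (Abelianization G)

/-- The natural projection of `G` onto the torsion-free part of its abelianisation. -/
def toFreeAb (G : Type*) [Group G] : G →* FreeAb G :=
  (QuotientGroup.mk' (CommGroup.torsion (Abelianization G))).comp Abelianization.of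

/-- An identification of the torsion-free part of the abelianisation of `G` with `ℤ^k`. -/
abbrev Coordinates (G : Type*) [Group G] (k : ℕ) : Type _ :=
  Additive (FreeAb G) ≃+ (Fin k → ℤ)

/-- The pairing `⟨v, π(g)⟩ = ∑ᵢ vᵢ π(g)ᵢ`, where `π(g) ∈ ℤ^k` is the image of `g` in the torsion-free
part of the abelianisation, read in the coordinates `e`. -/
noncomputable def pairing {G : Type*} [Group G] {k : ℕ} (e : Coordinates G k)
    (v : Fin k → ℝ) (g : G) : ℝ :=
  ∑ i, v i * (e (Additive.ofMul (toFreeAb G g)) i : ℝ)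

/-- `φ_μ(v) = ∑_g e^{⟨v, π(g)⟩} μ(g)`, with values in `[0, ∞]`. -/
noncomputable def phi {G : Type*} [Group G] {k : ℕ} (e : Coordinates G k) (μ : G → ℝ)
    (v : Fin k → ℝ) : ℝ≥0∞ :=
  ∑' g : G, ENNReal.ofReal (Real.exp (pairing e v g) * μ g)

/-- Coordinates exist for every finitely generated group. -/
theorem exists_coordinates (G : Type*) [Group G] [Group.FG G] :
    ∃ k : ℕ, Nonempty (Coordinates G k) := by
  have h1 : Group.FG (FreeAb G) :=
    Group.fg_of_surjective (f := toFreeAb G)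
      ((QuotientGroup.mk'_surjective _).comp (QuotientGroup.mk'_surjective _))
  have h2 : AddGroup.FG (Additive (FreeAb G)) := inferInstance
  have h3 : Module.Finite ℤ (Additive (FreeAb G)) := Module.Finite.iff_addGroup_fg.2 h2
  have h4 : IsMulTorsionFree (FreeAb G) := inferInstance
  have h5 : IsAddTorsionFree (Additive (FreeAb G)) := inferInstance
  have h6 : Module.Free ℤ (Additive (FreeAb G)) := inferInstance
  exact ⟨_, ⟨(Module.finBasis ℤ (Additive (FreeAb G))).equivFun.toAddEquiv⟩⟩

end RatioLimit

/-! Existence of ξ uses amenability. For t > λ the Green function Σ t⁻ⁿ μ^{*n} is positive and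
t-superharmonic. Averaging its logarithmic increments with the invariant mean gives a homomorphism ψ
: G → ℝ, and Jensen's inequality gives Σ μ e^ψ ≤ t. Letting t → λ and factoring ψ through ℤ^k gives
ξ with φ(ξ) ≤ λ (`exists_hom_le_spectralRadius`, `exists_pairing_eq`). Conversely φ ≥ λ everywhere:
tilting μ by e^{⟨v,π⟩}/φ(v) gives a probability measure, whose return probabilities μ^{*n}(e)/φ(v)ⁿ
are at most 1. Strict convexity gives uniqueness.

The tilt at ξ, normalised by λ, is a probability measure with subexponentially decaying return
probabilities, and for it both ratios must be shown to tend to 1. Cut a path into N blocks of length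
m plus a remainder, and let J count the blocks with increment g. Unconditionally J is binomial with
success probability c = μ^{*m}(g), so E[e^{tJ}] ≤ exp(Nc(e^t − 1)). Conditioned on a return to e,
cyclicity gives J the mean Ncρ, where ρ = μ^{*n}(g⁻¹)/μ^{*(n+m)}(e), and Jensen bounds the
conditional expectation below by exp(tNcρ). Conditioning costs only a subexponential factor, so tρ ≤
e^t − 1 + o(1); small t of both signs force ρ → 1. Quotients of such limits give the theorem
(`exp_mul_ratio_le`, `tendsto_ratio_shift`). -/

namespace RatioLimit

/-! ### Convolution powers and their supermultiplicativity -/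

section Convolution

variable {G : Type*} [Group G]

omit [Group G] in
lemma IsProbability.le_one {μ : G → ℝ} (hμ : IsProbability μ) (g : G) : μ g ≤ 1 :=
  le_hasSum hμ.hasSum_one g fun i _ => hμ.nonneg i

omit [Group G] in
lemma IsProbability.abs_le_one {μ : G → ℝ} (hμ : IsProbability μ) (g : G) : |μ g| ≤ 1 := by
  rw [abs_of_nonneg (hμ.nonneg g)]
  exact hμ.le_one g

/-- Convolving a summable function with a bounded one. -/
lemma summable_mul_bounded {μ f : G → ℝ} (hμ : Summable μ) (h0 : ∀ g, 0 ≤ μ g) {B : ℝ}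
    (hf : ∀ g, |f g| ≤ B) (x : G) : Summable fun s => μ s * f (s⁻¹ * x) := by
  refine Summable.of_norm_bounded (g := fun s => μ s * B) (hμ.mul_right B) fun s => ?_
  rw [norm_mul, Real.norm_of_nonneg (h0 s), Real.norm_eq_abs]
  exact mul_le_mul_of_nonneg_left (hf _) (h0 s)

lemma IsProbability.summable_conv {μ ν : G → ℝ} (hμ : IsProbability μ) (hν : IsProbability ν)
    (x : G) : Summable fun s => μ s * ν (s⁻¹ * x) :=
  summable_mul_bounded hμ.hasSum_one.summable hμ.nonneg (B := 1)
    hν.abs_le_one x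

/-- The shear `(x, s) ↦ (s, s⁻¹ x)` of `G × G`. -/
def shear (G : Type*) [Group G] : G × G ≃ G × G where
  toFun p := (p.2, p.2⁻¹ * p.1)
  invFun p := (p.1 * p.2, p.1)
  left_inv p := by simp
  right_inv p := by simp

lemma IsProbability.hasSum_shear {μ ν : G → ℝ} (hμ : IsProbability μ) (hν : IsProbability ν) :
    HasSum (fun p : G × G => μ p.2 * ν (p.2⁻¹ * p.1)) 1 := by
  have h := hμ.hasSum_one.mul hν.hasSum_one
    (hμ.hasSum_one.summable.mul_of_nonneg hν.hasSum_one.summable hμ.nonneg hν.nonneg)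
  rw [one_mul] at h
  exact (shear G).hasSum_iff.2 h

lemma IsProbability.conv {μ ν : G → ℝ} (hμ : IsProbability μ) (hν : IsProbability ν) :
    IsProbability (conv μ ν) where
  nonneg _ := tsum_nonneg fun _ => mul_nonneg (hμ.nonneg _) (hν.nonneg _)
  hasSum_one := (hμ.hasSum_shear hν).prod_fiberwise fun x => (hμ.summable_conv hν x).hasSum

/-- Absolute convergence justifies exchanging the sums. The third factor need only be bounded, since
`reweightDeriv` is not a probability. -/
lemma conv_assoc {μ ν ρ : G → ℝ} (hμ : IsProbability μ) (hν : IsProbability ν) {B : ℝ}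
    (hρ : ∀ x, |ρ x| ≤ B) : conv (conv μ ν) ρ = conv μ (conv ν ρ) := by
  funext x
  have hsum : Summable fun p : G × G => μ p.2 * ν (p.2⁻¹ * p.1) * ρ (p.1⁻¹ * x) := by
    refine Summable.of_norm_bounded ((hμ.hasSum_shear hν).summable.mul_right B) fun p => ?_
    have h0 := mul_nonneg (hμ.nonneg p.2) (hν.nonneg (p.2⁻¹ * p.1))
    rw [norm_mul, Real.norm_of_nonneg h0, Real.norm_eq_abs]
    exact mul_le_mul_of_nonneg_left (hρ _) h0
  have hsum' : Summable (Function.uncurry fun s y => μ s * ν (s⁻¹ * y) * ρ (y⁻¹ * x)) :=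
    (Equiv.prodComm G G).summable_iff.2 hsum
  calc conv (conv μ ν) ρ x
      = ∑' y, ∑' s, μ s * ν (s⁻¹ * y) * ρ (y⁻¹ * x) := by
        simp only [RatioLimit.conv, tsum_mul_right]
    _ = ∑' s, ∑' y, μ s * ν (s⁻¹ * y) * ρ (y⁻¹ * x) := hsum'.tsum_comm
    _ = ∑' s, μ s * ∑' r, ν r * ρ (r⁻¹ * (s⁻¹ * x)) := by
        refine tsum_congr fun s => ?_
        rw [← tsum_mul_left, ← (Equiv.mulLeft s).tsum_eq]
        refine tsum_congr fun r => ?_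
        simp [mul_assoc]

lemma conv_eq_tsum_right (μ ν : G → ℝ) (g : G) : conv μ ν g = ∑' y, ν y * μ (g * y⁻¹) := by
  rw [conv, ← ((Equiv.inv G).trans (Equiv.mulLeft g)).tsum_eq]
  refine tsum_congr fun y => ?_
  simp [mul_comm]

lemma isProbability_dirac : IsProbability (Set.indicator {1} 1 : G → ℝ) where
  nonneg := Set.indicator_nonneg fun _ _ => zero_le_one
  hasSum_one := by
    classical
    have := hasSum_ite_eq (1 : G) (1 : ℝ)
    convert this using 2 with g
    simp [Set.indicator_apply]

lemma IsProbability.convPow {μ : G → ℝ} (hμ : IsProbability μ) :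
    ∀ n, IsProbability (convPow μ n)
  | 0 => isProbability_dirac
  | n + 1 => hμ.conv (hμ.convPow n)

lemma dirac_conv (f : G → ℝ) : conv (Set.indicator {1} 1) f = f := by
  funext x
  rw [conv, tsum_eq_single 1]
  · simp
  · intro s hs
    simp [hs]

lemma conv_dirac (f : G → ℝ) : conv f (Set.indicator {1} 1) = f := by
  funext x
  rw [conv, tsum_eq_single x]
  · simp
  · intro s hs
    have : s⁻¹ * x ≠ 1 := fun h => hs (inv_mul_eq_one.1 h)
    simp [this]

lemma convPow_one (μ : G → ℝ) : convPow μ 1 = μ := conv_dirac μ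

lemma convPow_add {μ : G → ℝ} (hμ : IsProbability μ) (m n : ℕ) :
    convPow μ (m + n) = conv (convPow μ m) (convPow μ n) := by
  induction m with
  | zero => rw [Nat.zero_add]; exact (dirac_conv _).symm
  | succ m ih =>
    rw [Nat.add_right_comm]
    simp only [convPow]
    rw [ih, conv_assoc hμ (hμ.convPow m) (hμ.convPow n).abs_le_one]

lemma convPow_mul_le {μ : G → ℝ} (hμ : IsProbability μ) (m n : ℕ) (g h : G) :
    convPow μ m g * convPow μ n h ≤ convPow μ (m + n) (g * h) := by
  rw [convPow_add hμ]
  have := ((hμ.convPow m).summable_conv (hμ.convPow n) (g * h)).le_tsum g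
    fun s _ => mul_nonneg ((hμ.convPow m).nonneg _) ((hμ.convPow n).nonneg _)
  simpa [RatioLimit.conv] using this

lemma exists_convPow_pos {μ : G → ℝ} (hμ : IsProbability μ) (hnd : IsNondegenerate μ) (g : G) :
    ∃ n, 0 < convPow μ n g := by
  have hg : g ∈ Subsemigroup.closure {g : G | 0 < μ g} := by rw [hnd]; trivial
  induction hg using Subsemigroup.closure_induction with
  | mem x hx => exact ⟨1, by rw [convPow_one]; exact hx⟩
  | mul x y _ _ hx hy =>
    obtain ⟨m, hm⟩ := hx
    obtain ⟨n, hn⟩ := hy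
    exact ⟨m + n, (mul_pos hm hn).trans_le (convPow_mul_le hμ m n x y)⟩

/-- With aperiodicity every group element is charged by all large convolution powers. -/
lemma eventually_convPow_pos {μ : G → ℝ} (hμ : IsProbability μ) (hnd : IsNondegenerate μ)
    (hap : IsAperiodic μ) (g : G) : ∀ᶠ n in atTop, 0 < convPow μ n g := by
  obtain ⟨n₀, -, h₀⟩ := hap
  obtain ⟨m, hm⟩ := exists_convPow_pos hμ hnd g
  filter_upwards [eventually_ge_atTop (m + n₀)] with n hn
  have := convPow_mul_le hμ m (n - m) g 1
  rw [mul_one, Nat.add_sub_cancel' (by omega)] at this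
  exact (mul_pos hm (h₀ _ (by omega))).trans_le this

lemma pow_convPow_le {μ : G → ℝ} (hμ : IsProbability μ) (m q : ℕ) :
    convPow μ m 1 ^ q ≤ convPow μ (m * q) 1 := by
  induction q with
  | zero => simp [convPow]
  | succ q ih =>
    rw [pow_succ, Nat.mul_succ]
    refine (mul_le_mul_of_nonneg_right ih ((hμ.convPow m).nonneg 1)).trans ?_
    simpa using convPow_mul_le hμ (m * q) m 1 1

/-- The return probabilities of an aperiodic walk decay no faster than `θ ^ n`, as soon as one of
them (of positive order) is at least `θ ^ n`. -/
lemma exists_mul_pow_le_convPow {μ : G → ℝ} (hμ : IsProbability μ) (hap : IsAperiodic μ)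
    {θ : ℝ} (hθ : 0 < θ) (hθ1 : θ ≤ 1) {p : ℕ} (hp : 0 < p) (h : θ ^ p ≤ convPow μ p 1) :
    ∃ C > 0, ∀ᶠ n in atTop, C * θ ^ n ≤ convPow μ n 1 := by
  obtain ⟨n₀, -, h₀⟩ := hap
  -- Each n ≥ n₀ is n₀ plus a residue mod p plus a multiple of p. The constant is the least return
  -- probability over the p residues.
  obtain ⟨r₀, hr₀, hmin⟩ := (Finset.range p).exists_min_image (fun r => convPow μ (n₀ + r) 1)
    ⟨0, Finset.mem_range.2 hp⟩
  refine ⟨convPow μ (n₀ + r₀) 1, h₀ _ (by omega), ?_⟩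
  filter_upwards [eventually_ge_atTop n₀] with n hn
  obtain ⟨k, rfl⟩ := Nat.exists_eq_add_of_le hn
  have h1 : convPow μ (n₀ + r₀) 1 ≤ convPow μ (n₀ + k % p) 1 :=
    hmin _ (Finset.mem_range.2 (Nat.mod_lt _ hp))
  have h2 : θ ^ (n₀ + k) ≤ convPow μ p 1 ^ (k / p) := by
    calc θ ^ (n₀ + k) ≤ θ ^ (p * (k / p)) :=
          pow_le_pow_of_le_one hθ.le hθ1 ((Nat.mul_div_le k p).trans (by omega))
      _ = (θ ^ p) ^ (k / p) := pow_mul _ _ _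
      _ ≤ _ := pow_le_pow_left₀ (by positivity) h _
  have h3 := convPow_mul_le hμ (n₀ + k % p) (p * (k / p)) 1 1
  rw [add_assoc, Nat.mod_add_div, mul_one] at h3
  exact (mul_le_mul h1 (h2.trans (pow_convPow_le hμ _ _)) (by positivity)
    ((hμ.convPow _).nonneg _)).trans h3

end Convolution

/-! ### Reweighting one atom: an exponential moment for the number of its uses -/

section Reweight

variable {G : Type*} [Group G]

/-- Convolution with the measure `μ`, its atom at `g` (of mass `c`) being multiplied by `s`. -/
noncomputable def reweight (μ : G → ℝ) (g : G) (c s : ℝ) (f : G → ℝ) (x : G) : ℝ :=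
  ∑' y, (μ y - c * Set.indicator {g} 1 y) * f (y⁻¹ * x) + s * c * f (g⁻¹ * x)

/-- `s ↦ reweight^N f` differentiated at `s = 1`, see `reweight_iterate_ge`. -/
noncomputable def reweightDeriv (μ : G → ℝ) (g : G) (c : ℝ) (V : ℕ → G → ℝ) : ℕ → G → ℝ
  | 0 => 0
  | N + 1 => fun x => conv μ (reweightDeriv μ g c V N) x + c * V N (g⁻¹ * x)

variable {μ : G → ℝ}

omit [Group G] in
lemma remainder_nonneg (hμ : IsProbability μ) (g y : G) :
    0 ≤ μ y - μ g * Set.indicator {g} 1 y := by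
  by_cases h : y = g
  · simp [h]
  · simpa [h] using hμ.nonneg y

omit [Group G] in
lemma remainder_hasSum (hμ : IsProbability μ) (g : G) :
    HasSum (fun y => μ y - μ g * Set.indicator {g} 1 y) (1 - μ g) := by
  classical
  have h := hasSum_ite_eq g (μ g)
  refine hμ.hasSum_one.sub ?_
  have heq : (fun y => μ g * Set.indicator {g} 1 y) = fun y => if y = g then μ g else 0 := by
    funext y
    by_cases h : y = g <;> simp [h]
  rw [heq]
  exact h

lemma summable_remainder_mul (hμ : IsProbability μ) (g : G) {f : G → ℝ} {B : ℝ}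
    (hf : ∀ x, |f x| ≤ B) (x : G) :
    Summable fun y => (μ y - μ g * Set.indicator {g} 1 y) * f (y⁻¹ * x) :=
  summable_mul_bounded (remainder_hasSum hμ g).summable (remainder_nonneg hμ g) hf x

lemma tsum_remainder_mul (hμ : IsProbability μ) (g : G) {f : G → ℝ} {B : ℝ}
    (hf : ∀ x, |f x| ≤ B) (x : G) :
    ∑' y, (μ y - μ g * Set.indicator {g} 1 y) * f (y⁻¹ * x) = conv μ f x - μ g * f (g⁻¹ * x) := by
  classical
  have h := hasSum_ite_eq g (μ g * f (g⁻¹ * x))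
  have h2 := ((summable_mul_bounded hμ.hasSum_one.summable hμ.nonneg hf x).hasSum.sub h).tsum_eq
  rw [conv, ← h2]
  refine tsum_congr fun y => ?_
  by_cases h : y = g <;> simp [h]

lemma abs_conv_le (hμ : IsProbability μ) {f : G → ℝ} {B : ℝ} (hf : ∀ x, |f x| ≤ B) (x : G) :
    |conv μ f x| ≤ B := by
  have := tsum_of_norm_bounded (f := fun s => μ s * f (s⁻¹ * x)) (hμ.hasSum_one.mul_right B)
    fun s => by
      rw [norm_mul, Real.norm_of_nonneg (hμ.nonneg s), Real.norm_eq_abs]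
      exact mul_le_mul_of_nonneg_left (hf _) (hμ.nonneg s)
  simpa [conv] using this

/-- The reweighted measure has total mass 1 + (s − 1)μ(g), so each application multiplies a uniform
bound by at most this factor. -/
lemma reweight_iterate_mem (hμ : IsProbability μ) (g : G) {s : ℝ} (hs : 0 ≤ s) {f : G → ℝ}
    (hf : ∀ x, 0 ≤ f x ∧ f x ≤ 1) (N : ℕ) (x : G) :
    0 ≤ (reweight μ g (μ g) s)^[N] f x ∧
      (reweight μ g (μ g) s)^[N] f x ≤ (1 + (s - 1) * μ g) ^ N := by
  induction N generalizing x with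
  | zero => simpa using hf x
  | succ N ih =>
    rw [Function.iterate_succ_apply']
    set W := (reweight μ g (μ g) s)^[N] f
    have hsc : 0 ≤ s * μ g := mul_nonneg hs (hμ.nonneg g)
    have hη := remainder_nonneg hμ g
    have hsum := summable_remainder_mul hμ g (f := W) (B := (1 + (s - 1) * μ g) ^ N)
      (fun x => by rw [abs_of_nonneg (ih x).1]; exact (ih x).2) x
    refine ⟨add_nonneg (tsum_nonneg fun y => mul_nonneg (hη y) (ih _).1)
      (mul_nonneg hsc (ih _).1), ?_⟩
    have h1 := hsum.tsum_le_tsum (fun y => mul_le_mul_of_nonneg_left (ih (y⁻¹ * x)).2 (hη y))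
      ((remainder_hasSum hμ g).summable.mul_right _)
    rw [tsum_mul_right, (remainder_hasSum hμ g).tsum_eq] at h1
    have h2 := mul_le_mul_of_nonneg_left (ih (g⁻¹ * x)).2 hsc
    calc reweight μ g (μ g) s W x
        ≤ (1 - μ g) * (1 + (s - 1) * μ g) ^ N + s * μ g * (1 + (s - 1) * μ g) ^ N :=
          add_le_add h1 h2
      _ = (1 + (s - 1) * μ g) ^ (N + 1) := by ring

lemma reweightDeriv_bounded (hμ : IsProbability μ) (g : G) {V : ℕ → G → ℝ}
    (hV : ∀ N x, 0 ≤ V N x ∧ V N x ≤ 1) (N : ℕ) (x : G) :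
    |reweightDeriv μ g (μ g) V N x| ≤ N := by
  induction N generalizing x with
  | zero => simp [reweightDeriv]
  | succ N ih =>
    push_cast
    refine (abs_add_le _ _).trans (add_le_add (abs_conv_le hμ ih x) ?_)
    rw [abs_of_nonneg (mul_nonneg (hμ.nonneg g) (hV N _).1)]
    exact mul_le_one₀ (hμ.le_one g) (hV N _).1 (hV N _).2

/-- A tangent line inequality: the reweighted iterates are log-convex in `t = log s`. -/
lemma reweight_iterate_ge (hμ : IsProbability μ) (g : G) (t : ℝ) {V : ℕ → G → ℝ}
    (hV : ∀ N x, 0 ≤ V N x ∧ V N x ≤ 1) (hVs : ∀ N, V (N + 1) = conv μ (V N)) (N : ℕ) (a : ℝ)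
    (x : G) :
    Real.exp (a * t) * ((1 - a * t) * V N x + t * reweightDeriv μ g (μ g) V N x) ≤
      (reweight μ g (μ g) (Real.exp t))^[N] (V 0) x := by
  induction N generalizing a x with
  | zero =>
    simp only [reweightDeriv, Pi.zero_apply, mul_zero, add_zero, Function.iterate_zero, id]
    rw [← mul_assoc]
    refine mul_le_of_le_one_left (hV 0 x).1 ?_
    have h := Real.add_one_le_exp (-(a * t))
    calc Real.exp (a * t) * (1 - a * t) ≤ Real.exp (a * t) * Real.exp (-(a * t)) :=
          mul_le_mul_of_nonneg_left (by linarith) (Real.exp_pos _).le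
      _ = 1 := by rw [← Real.exp_add]; simp
  | succ N ih =>
    rw [Function.iterate_succ_apply']
    set s := Real.exp t with hs
    set W := (reweight μ g (μ g) s)^[N] (V 0)
    set D := reweightDeriv μ g (μ g) V N with hD
    have hVb : ∀ x, |V N x| ≤ 1 := fun x => by rw [abs_of_nonneg (hV N x).1]; exact (hV N x).2
    have hDb : ∀ x, |D x| ≤ N := reweightDeriv_bounded hμ g hV N
    have hWb : ∀ x, |W x| ≤ (1 + (s - 1) * μ g) ^ N := fun x => by
      have := reweight_iterate_mem hμ g (Real.exp_pos t).le (hV 0) N x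
      rw [abs_of_nonneg this.1]; exact this.2
    have hη := remainder_nonneg hμ g
    have sV := summable_remainder_mul hμ g hVb x
    have sD := summable_remainder_mul hμ g hDb x
    have sW := summable_remainder_mul hμ g hWb x
    have h1 : Real.exp (a * t) * ((1 - a * t) * (conv μ (V N) x - μ g * V N (g⁻¹ * x)) +
        t * (conv μ D x - μ g * D (g⁻¹ * x))) ≤
        ∑' y, (μ y - μ g * Set.indicator {g} 1 y) * W (y⁻¹ * x) := by
      rw [← tsum_remainder_mul hμ g hVb, ← tsum_remainder_mul hμ g hDb, ← tsum_mul_left,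
        ← tsum_mul_left, ← (sV.mul_left _).tsum_add (sD.mul_left _), ← tsum_mul_left]
      refine (((sV.mul_left _).add (sD.mul_left _)).mul_left _).tsum_le_tsum (fun y => ?_) sW
      refine le_of_eq_of_le ?_ (mul_le_mul_of_nonneg_left (ih a (y⁻¹ * x)) (hη y))
      ring
    -- When the first increment is g, one use is already counted, so the tangent point for the
    -- remaining N steps is a − 1. Hence the induction over all a.
    have h2 : Real.exp (a * t) * (μ g * ((1 - (a - 1) * t) * V N (g⁻¹ * x) + t * D (g⁻¹ * x))) ≤
        s * μ g * W (g⁻¹ * x) := by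
      refine le_of_eq_of_le ?_ (mul_le_mul_of_nonneg_left (ih (a - 1) (g⁻¹ * x))
        (mul_nonneg (Real.exp_pos t).le (hμ.nonneg g)))
      have : Real.exp (a * t) = s * Real.exp ((a - 1) * t) := by
        rw [hs, ← Real.exp_add]; congr 1; ring
      rw [this]; ring
    refine le_of_eq_of_le ?_ (add_le_add h1 h2)
    simp only [reweightDeriv, hVs, ← hD]
    ring

/-- Cyclicity of the trace `f ↦ f 1`: the derivative at the identity. -/
lemma conv_reweightDeriv {μ : G → ℝ} (hμ : IsProbability μ) (m r : ℕ) (g : G) (N j : ℕ) :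
    conv (convPow μ j)
        (reweightDeriv (convPow μ m) g (convPow μ m g) (fun N => convPow μ (m * N + r)) N) 1 =
      N * (convPow μ m g * convPow μ (j + m * (N - 1) + r) g⁻¹) := by
  have hV : ∀ N x, 0 ≤ convPow μ (m * N + r) x ∧ convPow μ (m * N + r) x ≤ 1 :=
    fun N x => ⟨(hμ.convPow _).nonneg x, (hμ.convPow _).le_one x⟩
  have hD := reweightDeriv_bounded (hμ.convPow m) g hV
  induction N generalizing j with
  | zero => simp [reweightDeriv, conv]
  | succ N ih =>
    have hE : ∀ x, |conv (convPow μ m) (reweightDeriv (convPow μ m) g (convPow μ m g)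
        (fun N => convPow μ (m * N + r)) N) x| ≤ N := abs_conv_le (hμ.convPow m) (hD N)
    have hsum : ∀ {f : G → ℝ} {B : ℝ}, (∀ x, |f x| ≤ B) →
        Summable fun y => convPow μ j y * f (y⁻¹ * 1) := fun hf =>
      summable_mul_bounded (hμ.convPow j).hasSum_one.summable (hμ.convPow j).nonneg hf 1
    -- The initial segment y moves to the end of the path: y g z = 1 exactly when z y = g⁻¹.
    have h1 : ∑' y, convPow μ j y * (convPow μ m g * convPow μ (m * N + r) (g⁻¹ * (y⁻¹ * 1))) =
        convPow μ m g * convPow μ (j + m * N + r) g⁻¹ := by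
      rw [show j + m * N + r = m * N + r + j by ring, convPow_add hμ (m * N + r) j,
        conv_eq_tsum_right, ← tsum_mul_left]
      refine tsum_congr fun y => ?_
      rw [mul_one]; ring
    -- A first block that is not singled out is absorbed into the preceding power, hence the free
    -- parameter j.
    have h2 := ih (j + m)
    rw [convPow_add hμ, conv_assoc (hμ.convPow j) (hμ.convPow m) (hD N)] at h2
    -- At N = 0 the subtraction N − 1 is truncated, but the factor N vanishes.
    have h3 : (N : ℝ) * (convPow μ m g * convPow μ (j + m + m * (N - 1) + r) g⁻¹) =
        N * (convPow μ m g * convPow μ (j + m * N + r) g⁻¹) := by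
      rcases N with _ | N
      · simp
      · rw [show j + m + m * (N + 1 - 1) + r = j + m * (N + 1) + r by
          rw [Nat.add_sub_cancel]; ring]
    rw [h3] at h2
    rw [conv] at h2 ⊢
    simp only [reweightDeriv, mul_add]
    rw [(hsum hE).tsum_add, h2, h1]
    · rw [Nat.add_sub_cancel]; push_cast; ring
    · refine hsum (f := fun x => convPow μ m g * convPow μ (m * N + r) (g⁻¹ * x)) (B := 1) fun x => ?_
      rw [abs_of_nonneg (mul_nonneg ((hμ.convPow m).nonneg g) (hV N _).1)]
      exact mul_le_one₀ ((hμ.convPow m).le_one g) (hV N _).1 (hV N _).2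

end Reweight

/-! ### Bounds on the spectral radius -/

section SpectralRadius

variable {G : Type*} [Group G] {μ : G → ℝ}

lemma root_nonneg (hμ : IsProbability μ) (n : ℕ) : 0 ≤ convPow μ n 1 ^ (1 / (n : ℝ)) :=
  Real.rpow_nonneg ((hμ.convPow n).nonneg 1) _

lemma root_le_one (hμ : IsProbability μ) (n : ℕ) : convPow μ n 1 ^ (1 / (n : ℝ)) ≤ 1 :=
  Real.rpow_le_one ((hμ.convPow n).nonneg 1) ((hμ.convPow n).le_one 1) (by positivity)

lemma isBoundedUnder_root (hμ : IsProbability μ) :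
    IsBoundedUnder (· ≤ ·) atTop fun n : ℕ => convPow μ n 1 ^ (1 / (n : ℝ)) :=
  isBoundedUnder_of ⟨1, root_le_one hμ⟩

lemma isCoboundedUnder_root (hμ : IsProbability μ) :
    IsCoboundedUnder (· ≤ ·) atTop fun n : ℕ => convPow μ n 1 ^ (1 / (n : ℝ)) :=
  (isBoundedUnder_of ⟨0, root_nonneg hμ⟩ : IsBoundedUnder (· ≥ ·) _ _).isCoboundedUnder_le

lemma spectralRadius_le_of_eventually (hμ : IsProbability μ) {t : ℝ} (ht : 0 ≤ t)
    (h : ∀ᶠ n in atTop, convPow μ n 1 ≤ t ^ n) : spectralRadius μ ≤ t := by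
  refine limsup_le_of_le (isCoboundedUnder_root hμ) ?_
  filter_upwards [h, eventually_gt_atTop 0] with n hn hn0
  have := Real.rpow_le_rpow ((hμ.convPow n).nonneg 1) hn (z := 1 / (n : ℝ)) (by positivity)
  rwa [one_div, Real.pow_rpow_inv_natCast ht hn0.ne', ← one_div] at this

lemma eventually_lt_pow (hμ : IsProbability μ) {t : ℝ} (h : spectralRadius μ < t) :
    ∀ᶠ n in atTop, convPow μ n 1 < t ^ n := by
  filter_upwards [eventually_lt_of_limsup_lt h (isBoundedUnder_root hμ), eventually_gt_atTop 0]
    with n hn hn0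
  have := pow_lt_pow_left₀ hn (root_nonneg hμ n) hn0.ne'
  rwa [one_div, Real.rpow_inv_natCast_pow ((hμ.convPow n).nonneg 1) hn0.ne'] at this

lemma exists_pow_lt (hμ : IsProbability μ) {t : ℝ} (ht : 0 ≤ t) (h : t < spectralRadius μ) :
    ∃ p, 0 < p ∧ t ^ p < convPow μ p 1 := by
  by_contra! hcon
  exact h.not_ge (spectralRadius_le_of_eventually hμ ht
    ((eventually_gt_atTop 0).mono fun n hn => hcon n hn))

lemma spectralRadius_nonneg (hμ : IsProbability μ) : 0 ≤ spectralRadius μ :=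
  le_limsup_of_frequently_le (Frequently.of_forall (root_nonneg hμ)) (isBoundedUnder_root hμ)

lemma spectralRadius_le_one (hμ : IsProbability μ) : spectralRadius μ ≤ 1 :=
  spectralRadius_le_of_eventually hμ zero_le_one
    (Eventually.of_forall fun n => by rw [one_pow]; exact (hμ.convPow n).le_one 1)

lemma spectralRadius_pos (hμ : IsProbability μ) (hap : IsAperiodic μ) : 0 < spectralRadius μ := by
  obtain ⟨n₀, h1, h₀⟩ := hap
  have ha := h₀ n₀ le_rfl
  refine lt_of_lt_of_le (Real.rpow_pos_of_pos ha (1 / (n₀ : ℝ)))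
    (le_limsup_of_frequently_le ?_ (isBoundedUnder_root hμ))
  -- Along multiples of n₀ the roots stay above μ^{*n₀}(e)^{1/n₀}, by supermultiplicativity.
  refine frequently_atTop.2 fun N => ⟨n₀ * (N + 1), by nlinarith, ?_⟩
  have hn : (n₀ : ℝ) ≠ 0 := by positivity
  have hN : ((N + 1 : ℕ) : ℝ) ≠ 0 := by positivity
  refine le_of_eq_of_le ?_ (Real.rpow_le_rpow (by positivity) (pow_convPow_le hμ n₀ (N + 1))
    (by positivity))
  rw [← Real.rpow_natCast, ← Real.rpow_mul ha.le]
  congr 1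
  rw [Nat.cast_mul]
  field_simp

end SpectralRadius

/-! ### The Green function -/

section Green

variable {G : Type*} [Group G] {μ : G → ℝ}

/-- Returning from g in k steps has fixed positive probability b, so μ^{*n}(g) ≤ μ^{*(n+k)}(e)/b,
which decays geometrically against tⁿ. -/
lemma summable_green (hμ : IsProbability μ) (hnd : IsNondegenerate μ) {t : ℝ}
    (ht : spectralRadius μ < t) (g : G) : Summable fun n => t⁻¹ ^ n * convPow μ n g := by
  obtain ⟨r, hr, hrt⟩ := exists_between ht
  have hr0 : 0 ≤ r := (spectralRadius_nonneg hμ).trans hr.le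
  have ht0 : 0 < t := hr0.trans_lt hrt
  obtain ⟨k, hk⟩ := exists_convPow_pos hμ hnd g⁻¹
  set b := convPow μ k g⁻¹
  have hgeo : Summable fun n : ℕ => r ^ k / b * (t⁻¹ * r) ^ n :=
    (summable_geometric_of_lt_one (by positivity)
      (by rw [inv_mul_lt_iff₀ ht0]; linarith)).mul_left _
  refine summable_of_isBigO_nat hgeo (Asymptotics.IsBigO.of_bound 1 ?_)
  filter_upwards [(tendsto_add_atTop_nat k).eventually (eventually_lt_pow hμ hr)] with n hn
  have h1 := convPow_mul_le hμ n k g g⁻¹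
  rw [mul_inv_cancel] at h1
  have h2 : convPow μ n g ≤ r ^ (n + k) / b := by
    rw [le_div_iff₀ hk]; exact h1.trans hn.le
  have h3 := (hμ.convPow n).nonneg g
  rw [one_mul, Real.norm_of_nonneg (by positivity), Real.norm_of_nonneg (by positivity)]
  refine (mul_le_mul_of_nonneg_left h2 (by positivity)).trans (le_of_eq ?_)
  rw [mul_pow, pow_add]; ring

/-- The Green function at `t` is a positive `t`-superharmonic function. -/
lemma exists_superharmonic (hμ : IsProbability μ) (hnd : IsNondegenerate μ) {t : ℝ}
    (ht : spectralRadius μ < t) :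
    ∃ u : G → ℝ, (∀ g, 0 < u g) ∧
      ∀ (F : Finset G) (g : G), ∑ s ∈ F, μ s * u (s⁻¹ * g) ≤ t * u g := by
  have ht0 : 0 < t := (spectralRadius_nonneg hμ).trans_lt ht
  have hsum := summable_green hμ hnd ht
  have hnn : ∀ g n, 0 ≤ t⁻¹ ^ n * convPow μ n g := fun g n =>
    mul_nonneg (by positivity) ((hμ.convPow n).nonneg g)
  refine ⟨fun g => ∑' n, t⁻¹ ^ n * convPow μ n g, fun g => ?_, fun F g => ?_⟩
  · obtain ⟨n, hn⟩ := exists_convPow_pos hμ hnd g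
    exact (hsum g).tsum_pos (hnn g) n (by positivity)
  · have hs1 : Summable fun n => t⁻¹ ^ (n + 1) * convPow μ (n + 1) g :=
      (summable_nat_add_iff (f := fun n => t⁻¹ ^ n * convPow μ n g) 1).2 (hsum g)
    have h0 : ∑ s ∈ F, μ s * ∑' n, t⁻¹ ^ n * convPow μ n (s⁻¹ * g) =
        ∑' n, ∑ s ∈ F, μ s * (t⁻¹ ^ n * convPow μ n (s⁻¹ * g)) := by
      rw [Summable.tsum_finsetSum fun s _ => (hsum _).mul_left _]
      exact Finset.sum_congr rfl fun s _ => tsum_mul_left.symm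
    have h1 : ∀ n, ∑ s ∈ F, μ s * (t⁻¹ ^ n * convPow μ n (s⁻¹ * g)) ≤
        t * (t⁻¹ ^ (n + 1) * convPow μ (n + 1) g) := fun n => by
      have h2 : ∑ s ∈ F, μ s * convPow μ n (s⁻¹ * g) ≤ convPow μ (n + 1) g :=
        (hμ.summable_conv (hμ.convPow n) g).sum_le_tsum F fun s _ =>
          mul_nonneg (hμ.nonneg s) ((hμ.convPow n).nonneg _)
      calc ∑ s ∈ F, μ s * (t⁻¹ ^ n * convPow μ n (s⁻¹ * g))
          = t⁻¹ ^ n * ∑ s ∈ F, μ s * convPow μ n (s⁻¹ * g) := by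
            rw [Finset.mul_sum]; exact Finset.sum_congr rfl fun s _ => by ring
        _ ≤ t⁻¹ ^ n * convPow μ (n + 1) g := mul_le_mul_of_nonneg_left h2 (by positivity)
        _ = t * (t⁻¹ ^ (n + 1) * convPow μ (n + 1) g) := by
            rw [pow_succ]; field_simp
    beta_reduce
    rw [h0, (hsum g).tsum_eq_zero_add, mul_add]
    refine le_trans ?_ (le_add_of_nonneg_left (mul_nonneg ht0.le (hnn g 0)))
    rw [← tsum_mul_left]
    exact (Summable.of_nonneg_of_le (fun n => Finset.sum_nonneg fun s _ =>
      mul_nonneg (hμ.nonneg s) (hnn _ n)) h1 (hs1.mul_left t)).tsum_le_tsum h1 (hs1.mul_left t)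

end Green

/-! ### From superharmonic functions to homomorphisms into ℝ -/

section Character

variable {G : Type*} [Group G] {μ : G → ℝ}

lemma IsNondegenerate.induction (hnd : IsNondegenerate μ) {P : G → Prop}
    (hmem : ∀ g, 0 < μ g → P g) (hmul : ∀ g h, P g → P h → P (g * h)) (g : G) : P g := by
  have hg : g ∈ Subsemigroup.closure {g : G | 0 < μ g} := by rw [hnd]; trivial
  induction hg using Subsemigroup.closure_induction with
  | mem x hx => exact hmem x hx
  | mul x y _ _ hx hy => exact hmul x y hx hy

/-- Harnack inequality for superharmonic functions. -/
lemma harnack (hnd : IsNondegenerate μ) {t : ℝ} {u : G → ℝ} (hu : ∀ g, 0 < u g)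
    (hsup : ∀ (F : Finset G) (g : G), ∑ s ∈ F, μ s * u (s⁻¹ * g) ≤ t * u g) (s : G) :
    ∃ C > 0, ∀ g, u (s⁻¹ * g) ≤ C * u g := by
  induction s using hnd.induction with
  | hmem s hs =>
    have h : ∀ g, u (s⁻¹ * g) ≤ t / μ s * u g := fun g => by
      have := hsup {s} g
      rw [Finset.sum_singleton] at this
      rw [div_mul_eq_mul_div, le_div_iff₀ hs]
      linarith
    exact ⟨t / μ s, pos_of_mul_pos_left ((hu _).trans_le (h 1)) (hu 1).le, h⟩
  | hmul s r hs hr =>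
    obtain ⟨C, hC, hs⟩ := hs
    obtain ⟨D, hD, hr⟩ := hr
    refine ⟨D * C, by positivity, fun g => ?_⟩
    rw [mul_inv_rev, mul_assoc, mul_assoc]
    exact (hr _).trans (mul_le_mul_of_nonneg_left (hs g) hD.le)

/-- A positive `t`-superharmonic function on an amenable group yields, by averaging its logarithmic
increments, a homomorphism `ψ : G → ℝ` with `∑ μ e^ψ ≤ t`. -/
lemma exists_hom_of_superharmonic (hG : IsAmenable G) (hμ : IsProbability μ)
    (hnd : IsNondegenerate μ) {t : ℝ}
    {u : G → ℝ} (hu : ∀ g, 0 < u g)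
    (hsup : ∀ (F : Finset G) (g : G), ∑ s ∈ F, μ s * u (s⁻¹ * g) ≤ t * u g) :
    ∃ ψ : G → ℝ, (∀ g h, ψ (g * h) = ψ g + ψ h) ∧
      ∀ F : Finset G, ∑ s ∈ F, μ s * Real.exp (ψ s) ≤ t := by
  obtain ⟨M, hM1, hMb, hMinv⟩ := hG
  have hmem : ∀ s : G, Memℓp (fun g => Real.log (u (s⁻¹ * g)) - Real.log (u g)) ∞ := fun s => by
    obtain ⟨C, hC, h1⟩ := harnack hnd hu hsup s
    obtain ⟨D, hD, h2⟩ := harnack hnd hu hsup s⁻¹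
    refine memℓp_infty ⟨max (Real.log C) (Real.log D), ?_⟩
    rintro _ ⟨g, rfl⟩
    have h3 := Real.log_le_log (hu _) (h1 g)
    have h4 := Real.log_le_log (hu _) (h2 (s⁻¹ * g))
    rw [inv_inv, mul_inv_cancel_left] at h4
    rw [Real.log_mul (by positivity) (hu _).ne'] at h3 h4
    dsimp only
    rw [Real.norm_eq_abs, abs_le']
    exact ⟨le_max_of_le_left (by linarith), le_max_of_le_right (by linarith)⟩
  let f : G → lp (fun _ : G => ℝ) ∞ := fun s => ⟨_, hmem s⟩
  have hf : ∀ s g, f s g = Real.log (u (s⁻¹ * g)) - Real.log (u g) := fun s g => rfl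
  have hfexp : ∀ s g, u (s⁻¹ * g) = Real.exp (f s g) * u g := fun s g => by
    rw [hf, Real.exp_sub, Real.exp_log (hu _), Real.exp_log (hu _), div_mul_cancel₀ _ (hu g).ne']
  refine ⟨fun s => M (f s), fun s r => ?_, fun F => ?_⟩
  -- Cocycle identity: f(sr) − f(s) is the translate of f(r) by s⁻¹.
  · have h2 : M (f (s * r) - f s) = M (f r) := by
      refine hMinv s⁻¹ (f r) _ fun x => ?_
      rw [lp.coeFn_sub, Pi.sub_apply, hf, hf, hf, mul_inv_rev, mul_assoc]
      ring
    rw [map_sub] at h2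
    linarith
  -- Jensen for a finitely additive mean: h replaces each exp(f s) by its tangent at M(f s). Thus h
  -- ≤ t pointwise, while M(h) is the desired sum.
  · let h : lp (fun _ : G => ℝ) ∞ := ∑ s ∈ F, (μ s * Real.exp (M (f s))) • (f s + (1 - M (f s)) • 1)
    have hh : ∀ g, h g = ∑ s ∈ F, μ s * Real.exp (M (f s)) * (f s g + (1 - M (f s))) := fun g => by
      simp only [h, lp.coeFn_sum, Finset.sum_apply, lp.coeFn_smul, Pi.smul_apply, lp.coeFn_add,
        Pi.add_apply, smul_eq_mul, lp.infty_coeFn_one, Pi.one_apply, mul_one]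
    have hMh : M h = ∑ s ∈ F, μ s * Real.exp (M (f s)) := by
      simp only [h, map_sum, map_smul, map_add, hM1, smul_eq_mul]
      exact Finset.sum_congr rfl fun s _ => by ring
    rw [← hMh]
    refine (hMb h).2.trans (ciSup_le fun g => ?_)
    rw [hh]
    have h1 := hsup F g
    simp only [hfexp, ← mul_assoc, ← Finset.sum_mul] at h1
    refine le_trans (Finset.sum_le_sum fun s _ => ?_) (le_of_mul_le_mul_right h1 (hu g))
    rw [mul_assoc]
    refine mul_le_mul_of_nonneg_left ?_ (hμ.nonneg s)
    calc Real.exp (M (f s)) * (f s g + (1 - M (f s)))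
        ≤ Real.exp (M (f s)) * Real.exp (f s g - M (f s)) :=
          mul_le_mul_of_nonneg_left (by linarith [Real.add_one_le_exp (f s g - M (f s))])
            (Real.exp_pos _).le
      _ = Real.exp (f s g) := by rw [← Real.exp_add]; congr 1; ring

/-- Passing to the limit `t → λ` along an ultrafilter. -/
lemma exists_hom_le_spectralRadius (hG : IsAmenable G) (hμ : IsProbability μ)
    (hnd : IsNondegenerate μ) :
    ∃ ψ : G → ℝ, (∀ g h, ψ (g * h) = ψ g + ψ h) ∧
      ∀ F : Finset G, ∑ s ∈ F, μ s * Real.exp (ψ s) ≤ spectralRadius μ := by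
  have key : ∀ n : ℕ, ∃ ψ : G → ℝ, (∀ g h, ψ (g * h) = ψ g + ψ h) ∧
      ∀ F : Finset G, ∑ s ∈ F, μ s * Real.exp (ψ s) ≤ spectralRadius μ + 1 / ((n : ℝ) + 1) :=
    fun n => by
      obtain ⟨u, hu, hsup⟩ := exists_superharmonic hμ hnd
        (t := spectralRadius μ + 1 / ((n : ℝ) + 1)) (lt_add_of_pos_right _ (by positivity))
      exact exists_hom_of_superharmonic hG hμ hnd hu hsup
  choose ψ hadd hle using key
  have hone : ∀ n, ψ n 1 = 0 := fun n => by simpa using hadd n 1 1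
  have hinv : ∀ n g, ψ n g⁻¹ = -ψ n g := fun n g => by
    have := hadd n g⁻¹ g
    rw [inv_mul_cancel, hone] at this
    linarith
  -- Upper bounds hold on the support and pass to products; applied to g⁻¹ they give the lower
  -- bounds that compactness requires.
  have hub : ∀ g, ∃ B, ∀ n, ψ n g ≤ B := fun g => by
    induction g using hnd.induction with
    | hmem s hs =>
      refine ⟨Real.log (2 / μ s), fun n => ?_⟩
      have h1 := hle n {s}
      rw [Finset.sum_singleton] at h1
      have h2 : 1 / ((n : ℝ) + 1) ≤ 1 := by
        rw [div_le_one (by positivity)]; linarith [Nat.cast_nonneg (α := ℝ) n]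
      have h3 := spectralRadius_le_one hμ
      rw [Real.le_log_iff_exp_le (by positivity), le_div_iff₀ hs]
      linarith
    | hmul s r hs hr =>
      obtain ⟨A, hA⟩ := hs
      obtain ⟨B, hB⟩ := hr
      exact ⟨A + B, fun n => by rw [hadd]; exact add_le_add (hA n) (hB n)⟩
  have hlim : ∀ g, ∃ x, Tendsto (fun n => ψ n g) (hyperfilter ℕ : Filter ℕ) (𝓝 x) := fun g => by
    obtain ⟨B, hB⟩ := hub g
    obtain ⟨A, hA⟩ := hub g⁻¹
    obtain ⟨x, -, hx⟩ := (isCompact_Icc (a := -A) (b := B)).ultrafilter_le_nhds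
      ((hyperfilter ℕ).map fun n => ψ n g) (by
        rw [le_principal_iff]
        refine Ultrafilter.mem_map.2 (univ_mem' fun n => ⟨?_, hB n⟩)
        have := hA n
        rw [hinv] at this
        linarith)
    exact ⟨x, hx⟩
  choose Ψ hΨ using hlim
  refine ⟨Ψ, fun g h => ?_, fun F => ?_⟩
  · refine tendsto_nhds_unique (hΨ (g * h)) (((hΨ g).add (hΨ h)).congr fun n => ?_)
    exact (hadd n g h).symm
  · have h1 : Tendsto (fun n : ℕ => spectralRadius μ + 1 / ((n : ℝ) + 1)) (hyperfilter ℕ)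
        (𝓝 (spectralRadius μ)) := by
      have := (tendsto_one_div_add_atTop_nhds_zero_nat (𝕜 := ℝ)).const_add (spectralRadius μ)
      rw [add_zero] at this
      exact this.mono_left Nat.hyperfilter_le_atTop
    refine le_of_tendsto_of_tendsto' (tendsto_finsetSum F fun s _ =>
      ((Real.continuous_exp.tendsto _).comp (hΨ s)).const_mul (μ s)) h1 fun n => hle n F

/-- Every homomorphism to `ℝ` is given by a vector in coordinates. -/
lemma exists_pairing_eq {k : ℕ} (e : Coordinates G k) {ψ : G → ℝ}
    (hψ : ∀ g h, ψ (g * h) = ψ g + ψ h) : ∃ v, ∀ g, pairing e v g = ψ g := by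
  let f : G →* Multiplicative ℝ :=
    MonoidHom.mk' (fun g => Multiplicative.ofAdd (ψ g)) fun g h => by rw [hψ]; rfl
  let f₁ : Abelianization G →* Multiplicative ℝ := Abelianization.lift f
  have htor : CommGroup.torsion (Abelianization G) ≤ f₁.ker := fun x hx => by
    obtain ⟨n, hn, hx⟩ := (isOfFinOrder_iff_pow_eq_one).1 hx
    have h1 : f₁ x ^ n = 1 := by rw [← map_pow, hx, map_one]
    have h2 : n • (f₁ x).toAdd = 0 := by rw [← toAdd_pow, h1]; rfl
    have h3 : (f₁ x).toAdd = 0 := (smul_eq_zero.1 h2).resolve_left hn.ne'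
    exact h3
  let f₂ : FreeAb G →* Multiplicative ℝ := QuotientGroup.lift _ f₁ htor
  have hf₂ : ∀ g, f₂ (toFreeAb G g) = Multiplicative.ofAdd (ψ g) := fun g => by
    simp [f₂, toFreeAb, f₁, f]
  let f₃ : (Fin k → ℤ) →+ ℝ := (MonoidHom.toAdditiveLeft f₂).comp e.symm.toAddMonoidHom
  refine ⟨fun i => f₃ (Pi.single i 1), fun g => ?_⟩
  have h1 : f₃ (e (Additive.ofMul (toFreeAb G g))) = ψ g := by
    simp [f₃, hf₂]
  rw [← h1]
  set m := e (Additive.ofMul (toFreeAb G g)) with hm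
  have h2 : m = ∑ i, m i • Pi.single i (1 : ℤ) := by
    ext j
    simp [Finset.sum_apply, Pi.single_apply]
  conv_rhs => rw [h2, map_sum]
  refine Finset.sum_congr rfl fun i _ => ?_
  rw [map_zsmul, zsmul_eq_mul, mul_comm]

end Character

/-! ### Ratio limits under subexponential decay -/

section CriticalRatio

variable {G : Type*} [Group G] {μ : G → ℝ}

/-- Jensen for the number of blocks with increment g, conditioned on a return at time mN + r,
against the unconditioned exponential moment. -/
lemma exp_mul_ratio_le (hμ : IsProbability μ) (m N r : ℕ) (g : G) (t : ℝ)
    (hpos : 0 < convPow μ (m * N + r) 1) :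
    Real.exp (t * (N * (convPow μ m g * convPow μ (m * (N - 1) + r) g⁻¹) /
      convPow μ (m * N + r) 1)) * convPow μ (m * N + r) 1 ≤
      Real.exp (N * (convPow μ m g * (Real.exp t - 1))) := by
  set c := convPow μ m g with hc
  have hP := hμ.convPow m
  have hc0 : 0 ≤ c := hP.nonneg g
  have hV : ∀ N x, 0 ≤ convPow μ (m * N + r) x ∧ convPow μ (m * N + r) x ≤ 1 :=
    fun N x => ⟨(hμ.convPow _).nonneg x, (hμ.convPow _).le_one x⟩
  -- The conditional mean of the count: with this tangent point the linear terms cancel and only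
  -- e^{at} times the return probability remains.
  set a := N * (c * convPow μ (m * (N - 1) + r) g⁻¹) / convPow μ (m * N + r) 1 with ha
  have hD : reweightDeriv (convPow μ m) g c (fun N => convPow μ (m * N + r)) N 1 =
      N * (c * convPow μ (m * (N - 1) + r) g⁻¹) := by
    have := conv_reweightDeriv hμ m r g N 0
    rw [convPow, dirac_conv, Nat.zero_add] at this
    exact this
  have h1 := reweight_iterate_ge hP g t hV
    (fun N => by rw [← convPow_add hμ]; congr 1; ring) N a 1
  have h2 := (reweight_iterate_mem hP g (Real.exp_pos t).le (hV 0) N 1).2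
  have h3 : (1 + (Real.exp t - 1) * c) ^ N ≤ Real.exp (N * (c * (Real.exp t - 1))) := by
    rw [Real.exp_nat_mul]
    refine pow_le_pow_left₀ ?_ ?_ N
    · nlinarith [Real.exp_pos t, hP.le_one g, mul_nonneg (Real.exp_pos t).le hc0]
    · linarith [Real.add_one_le_exp (c * (Real.exp t - 1))]
  refine le_trans (le_of_eq ?_) (h1.trans (h2.trans h3))
  rw [← hc, hD, mul_comm t a]
  have : N * (c * convPow μ (m * (N - 1) + r) g⁻¹) = a * convPow μ (m * N + r) 1 := by
    rw [ha, div_mul_cancel₀ _ hpos.ne']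
  rw [this]; ring

/-- The return probabilities decay slower than any exponential. -/
def IsCritical (μ : G → ℝ) : Prop :=
  ∀ δ > 0, ∃ C > 0, ∀ᶠ n : ℕ in atTop, C * Real.exp (-δ * n) ≤ convPow μ n 1

/-- Taking logarithms and dividing by Nc leaves e^t − 1 ≤ t + t² plus the cost of conditioning,
which criticality makes at most t². -/
lemma eventually_mul_ratio_le (hμ : IsProbability μ) (hcrit : IsCritical μ) {m : ℕ} (hm : 0 < m)
    {g : G} (hg : 0 < convPow μ m g) {t : ℝ} (ht : t ≠ 0) (ht1 : |t| ≤ 1) :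
    ∀ᶠ n in atTop, t * (convPow μ n g⁻¹ / convPow μ (n + m) 1) ≤ t + 2 * t ^ 2 := by
  set c := convPow μ m g with hc
  have hm' : (0 : ℝ) < m := by exact_mod_cast hm
  have ht2 : 0 < t ^ 2 := by positivity
  -- Since n + m ≤ 2mN, this makes δ(n + m) at most Nct²/2; the other half of the allowance absorbs
  -- −log C.
  set δ := c * t ^ 2 / (4 * m) with hδ
  have hδ0 : 0 < δ := by positivity
  obtain ⟨C, hC, hlow⟩ := hcrit δ hδ0
  have hlow' := (tendsto_add_atTop_nat m).eventually hlow
  have hdiv : Tendsto (fun n : ℕ => ((n / m : ℕ) : ℝ) + 1) atTop atTop :=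
    tendsto_atTop_add_const_right _ _
      (tendsto_natCast_atTop_atTop.comp (Nat.tendsto_div_const_atTop hm.ne'))
  filter_upwards [hlow', hdiv.eventually_ge_atTop (-Real.log C / (c * t ^ 2 / 2))] with n h1 h2
  have hn : m * (n / m + 1) + n % m = n + m := by
    have := Nat.div_add_mod n m
    rw [mul_add]; omega
  have hn' : m * (n / m + 1 - 1) + n % m = n := by
    rw [Nat.add_sub_cancel]; exact Nat.div_add_mod n m
  have hpos : 0 < convPow μ (n + m) 1 := (mul_pos hC (Real.exp_pos _)).trans_le h1
  have h3 := exp_mul_ratio_le hμ m (n / m + 1) (n % m) g t (by rw [hn]; exact hpos)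
  rw [hn, hn', ← hc] at h3
  set ρ := convPow μ n g⁻¹ / convPow μ (n + m) 1 with hρ
  set N : ℝ := ((n / m : ℕ) : ℝ) + 1 with hN
  have hN1 : 1 ≤ N := by rw [hN]; linarith [Nat.cast_nonneg (α := ℝ) (n / m)]
  have hcast : ((n / m + 1 : ℕ) : ℝ) = N := by push_cast; rfl
  rw [hcast] at h3
  have h4 : Real.exp (t * (N * c * ρ) + (Real.log C + -δ * (n + m : ℕ))) ≤
      Real.exp (N * (c * (Real.exp t - 1))) := by
    refine le_trans ?_ h3
    rw [Real.exp_add, Real.exp_add (Real.log C), Real.exp_log hC]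
    refine (mul_le_mul_of_nonneg_left h1 (Real.exp_pos _).le).trans (le_of_eq ?_)
    rw [hρ]; congr 3; ring
  rw [Real.exp_le_exp] at h4
  have h5 : ((n + m : ℕ) : ℝ) ≤ 2 * m * N := by
    have : n + m ≤ 2 * m * (n / m + 1) := by
      rw [← hn]
      have := Nat.mod_lt n hm
      nlinarith [Nat.zero_le (m * (n / m))]
    have h' : ((n + m : ℕ) : ℝ) ≤ ((2 * m * (n / m + 1) : ℕ) : ℝ) := by exact_mod_cast this
    rw [← hcast]
    refine h'.trans (le_of_eq ?_)
    push_cast; ring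
  have h6 : δ * (n + m : ℕ) ≤ N * c * (t ^ 2 / 2) := by
    refine (mul_le_mul_of_nonneg_left h5 hδ0.le).trans (le_of_eq ?_)
    rw [hδ]; field_simp; ring
  have h7 : -Real.log C ≤ N * c * (t ^ 2 / 2) := by
    rw [div_le_iff₀ (by positivity)] at h2
    linarith
  have h8 : Real.exp t - 1 ≤ t + t ^ 2 := by
    have := (abs_le.1 (Real.abs_exp_sub_one_sub_id_le ht1)).2
    linarith
  have hNc : 0 < N * c := by positivity
  have h9 : N * c * (t * ρ) ≤ N * c * (t + 2 * t ^ 2) := by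
    have := mul_le_mul_of_nonneg_left h8 hNc.le
    nlinarith
  exact le_of_mul_le_mul_left h9 hNc

lemma tendsto_ratio_shift (hμ : IsProbability μ) (hcrit : IsCritical μ) {m : ℕ} (hm : 0 < m)
    {g : G} (hg : 0 < convPow μ m g) :
    Tendsto (fun n => convPow μ n g⁻¹ / convPow μ (n + m) 1) atTop (𝓝 1) := by
  rw [Metric.tendsto_nhds]
  intro ε hε
  -- The bounds at t and −t give |ρ − 1| ≤ 2t < ε.
  obtain ⟨t, ht, htε⟩ : ∃ t : ℝ, 0 < t ∧ t < min 1 (ε / 2) := exists_between (by positivity)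
  obtain ⟨ht1, htε⟩ := lt_min_iff.1 htε
  have hab : |t| ≤ 1 := by rw [abs_of_pos ht]; exact ht1.le
  filter_upwards [eventually_mul_ratio_le hμ hcrit hm hg ht.ne' hab,
    eventually_mul_ratio_le hμ hcrit hm hg (neg_ne_zero.2 ht.ne') (by rwa [abs_neg])] with n h1 h2
  rw [Real.dist_eq, abs_lt]
  constructor <;> nlinarith

/-- The ratio limit theorem for measures whose return probabilities decay subexponentially. -/
lemma IsCritical.tendsto_ratio (hcrit : IsCritical μ) (hμ : IsProbability μ)
    (hnd : IsNondegenerate μ) (hap : IsAperiodic μ) (g : G) :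
    Tendsto (fun n => convPow μ n g / convPow μ n 1) atTop (𝓝 1) ∧
      Tendsto (fun n => convPow μ (n + 1) 1 / convPow μ n 1) atTop (𝓝 1) := by
  have hone := eventually_convPow_pos hμ hnd hap 1
  -- One m serves all three shifts: m for g⁻¹, and m and m + 1 for the identity. Quotients then
  -- cancel the common terms.
  obtain ⟨m, hm, h1, h2, h3⟩ := ((eventually_gt_atTop 0).and
    ((eventually_convPow_pos hμ hnd hap g⁻¹).and
      (hone.and ((tendsto_add_atTop_nat 1).eventually hone)))).exists
  have r1 := tendsto_ratio_shift hμ hcrit hm h1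
  have r2 := tendsto_ratio_shift hμ hcrit hm h2
  have r3 := tendsto_ratio_shift hμ hcrit (Nat.succ_pos m) h3
  simp only [inv_inv, inv_one] at r1 r2 r3
  constructor
  · have := r1.div r2 one_ne_zero
    rw [div_one] at this
    refine this.congr' ?_
    filter_upwards [hone, (tendsto_add_atTop_nat m).eventually hone] with n _ hn
    rw [Pi.div_apply, div_div_div_cancel_right₀ hn.ne']
  · have := r2.div r3 one_ne_zero
    rw [div_one] at this
    rw [← tendsto_add_atTop_iff_nat m]
    refine this.congr' ?_
    filter_upwards [hone] with n hn
    rw [Pi.div_apply, div_div_div_cancel_left' _ _ hn.ne']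
    rfl

end CriticalRatio

/-! ### Exponential tilts and the function φ -/

section Tilt

variable {G : Type*} [Group G] {μ : G → ℝ} {k : ℕ} (e : Coordinates G k)

lemma pairing_mul (v : Fin k → ℝ) (g h : G) :
    pairing e v (g * h) = pairing e v g + pairing e v h := by
  simp [pairing, mul_add, Finset.sum_add_distrib]

lemma pairing_one (v : Fin k → ℝ) : pairing e v 1 = 0 := by
  simpa using pairing_mul e v 1 1

/-- The pairing is non-degenerate: `π` is onto. -/
lemma pairing_injective {v w : Fin k → ℝ} (h : ∀ g : G, pairing e v g = pairing e w g) :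
    v = w := by
  funext i
  obtain ⟨a, ha⟩ := e.surjective (Pi.single i 1)
  have hsurj : Function.Surjective (toFreeAb G) :=
    (QuotientGroup.mk'_surjective _).comp (QuotientGroup.mk'_surjective _)
  obtain ⟨g, hg⟩ := hsurj a.toMul
  have := h g
  simp only [pairing, hg, ofMul_toMul, ha] at this
  simpa [Pi.single_apply] using this

/-- The exponential tilt of `μ`, normalised by `κ`. -/
noncomputable def tilt (μ : G → ℝ) (v : Fin k → ℝ) (κ : ℝ) (g : G) : ℝ :=
  Real.exp (pairing e v g) * μ g / κ

/-- The weight e^{⟨v,π⟩} is multiplicative, so along a path it depends only on the endpoint. -/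
lemma convPow_tilt (v : Fin k → ℝ) {κ : ℝ} (n : ℕ) (g : G) :
    convPow (tilt e μ v κ) n g = Real.exp (pairing e v g) * convPow μ n g / κ ^ n := by
  induction n generalizing g with
  | zero =>
    by_cases h : g = 1
    · simp [convPow, h, pairing_one]
    · simp [convPow, h]
  | succ n ih =>
    simp only [convPow, conv]
    rw [← tsum_mul_left, ← tsum_div_const]
    refine tsum_congr fun s => ?_
    have h : pairing e v g = pairing e v s + pairing e v (s⁻¹ * g) := by
      rw [← pairing_mul, mul_inv_cancel_left]
    rw [ih, tilt, h, Real.exp_add, pow_succ]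
    ring

variable {e}

lemma isProbability_tilt (hμ : IsProbability μ) {v : Fin k → ℝ} {κ : ℝ} (hκ : 0 < κ)
    (h : HasSum (fun g => Real.exp (pairing e v g) * μ g) κ) : IsProbability (tilt e μ v κ) where
  nonneg g := div_nonneg (mul_nonneg (Real.exp_pos _).le (hμ.nonneg g)) hκ.le
  hasSum_one := by
    have := h.div_const κ
    rwa [div_self hκ.ne'] at this

lemma tilt_pos_iff {v : Fin k → ℝ} {κ : ℝ} (hκ : 0 < κ) (g : G) :
    0 < tilt e μ v κ g ↔ 0 < μ g := by
  rw [tilt, div_pos_iff_of_pos_right hκ, mul_pos_iff_of_pos_left (Real.exp_pos _)]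

lemma isNondegenerate_tilt (hnd : IsNondegenerate μ) {v : Fin k → ℝ} {κ : ℝ} (hκ : 0 < κ) :
    IsNondegenerate (tilt e μ v κ) := by
  simpa only [IsNondegenerate, tilt_pos_iff hκ] using hnd

lemma isAperiodic_tilt (hap : IsAperiodic μ) {v : Fin k → ℝ} {κ : ℝ} (hκ : 0 < κ) :
    IsAperiodic (tilt e μ v κ) := by
  obtain ⟨n₀, h1, h⟩ := hap
  refine ⟨n₀, h1, fun n hn => ?_⟩
  rw [convPow_tilt]
  have := h n hn
  positivity

/-- Return probabilities of the tilted measure are at most 1, and tilting only divides those of μ by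
κⁿ. -/
lemma spectralRadius_le_of_hasSum (hμ : IsProbability μ) {v : Fin k → ℝ} {κ : ℝ}
    (h : HasSum (fun g => Real.exp (pairing e v g) * μ g) κ) : spectralRadius μ ≤ κ := by
  have hnn : ∀ g, 0 ≤ Real.exp (pairing e v g) * μ g := fun g =>
    mul_nonneg (Real.exp_pos _).le (hμ.nonneg g)
  have hκ : 0 < κ := by
    refine (h.nonneg hnn).lt_of_ne fun h0 => ?_
    rw [← h0, hasSum_zero_iff_of_nonneg hnn] at h
    have hμ0 : μ = 0 := by
      funext g
      exact (mul_eq_zero.1 (congrFun h g)).resolve_left (Real.exp_pos _).ne'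
    have := hμ.hasSum_one
    rw [hμ0] at this
    exact zero_ne_one (hasSum_zero.unique this)
  refine spectralRadius_le_of_eventually hμ hκ.le (Eventually.of_forall fun n => ?_)
  have := ((isProbability_tilt hμ hκ h).convPow n).le_one 1
  rwa [convPow_tilt, pairing_one, Real.exp_zero, one_mul, div_le_one (by positivity)] at this

/-- Some return probability of μ beats (e^{−δ}λ)^p; supermultiplicativity and aperiodicity spread
this to all large times, and dividing by λⁿ leaves e^{−δn}. -/
lemma isCritical_tilt (hμ : IsProbability μ) (hap : IsAperiodic μ) (v : Fin k → ℝ) :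
    IsCritical (tilt e μ v (spectralRadius μ)) := by
  intro δ hδ
  have hr := spectralRadius_pos hμ hap
  set r := spectralRadius μ with hr'
  have hexp : Real.exp (-δ) < 1 := by
    rw [← Real.exp_zero]
    exact Real.exp_lt_exp.2 (by linarith)
  obtain ⟨p, hp, h⟩ := exists_pow_lt hμ (t := Real.exp (-δ) * r) (by positivity)
    (mul_lt_of_lt_one_left hr hexp)
  obtain ⟨C, hC, hle⟩ := exists_mul_pow_le_convPow hμ hap (θ := Real.exp (-δ) * r)
    (by positivity) (mul_le_one₀ hexp.le hr.le (spectralRadius_le_one hμ)) hp h.le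
  refine ⟨C, hC, hle.mono fun n hn => ?_⟩
  rw [convPow_tilt, pairing_one, Real.exp_zero, one_mul, le_div_iff₀ (by positivity),
    mul_comm (-δ), Real.exp_nat_mul]
  rwa [mul_pow, ← mul_assoc] at hn

lemma phi_eq_of_hasSum (hμ : IsProbability μ) {v : Fin k → ℝ} {κ : ℝ}
    (h : HasSum (fun g => Real.exp (pairing e v g) * μ g) κ) :
    phi e μ v = ENNReal.ofReal κ := by
  rw [phi, ← h.tsum_eq, ENNReal.ofReal_tsum_of_nonneg _ h.summable]
  exact fun g => mul_nonneg (Real.exp_pos _).le (hμ.nonneg g)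

lemma hasSum_of_phi_ne_top (hμ : IsProbability μ) {v : Fin k → ℝ} (h : phi e μ v ≠ ⊤) :
    ∃ κ, HasSum (fun g => Real.exp (pairing e v g) * μ g) κ := by
  have := ENNReal.summable_toReal h
  simp only [ENNReal.toReal_ofReal (mul_nonneg (Real.exp_pos _).le (hμ.nonneg _))] at this
  exact ⟨_, this.hasSum⟩

lemma hasSum_of_phi_eq (hμ : IsProbability μ) {v : Fin k → ℝ} {t : ℝ} (ht : 0 ≤ t)
    (h : phi e μ v = ENNReal.ofReal t) :
    HasSum (fun g => Real.exp (pairing e v g) * μ g) t := by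
  obtain ⟨κ, hκ⟩ := hasSum_of_phi_ne_top hμ (h ▸ ENNReal.ofReal_ne_top)
  have hκ0 : 0 ≤ κ := hκ.nonneg fun g => mul_nonneg (Real.exp_pos _).le (hμ.nonneg g)
  rw [phi_eq_of_hasSum hμ hκ, ENNReal.ofReal_eq_ofReal_iff hκ0 ht] at h
  rwa [h] at hκ

lemma spectralRadius_le_phi (hμ : IsProbability μ) (v : Fin k → ℝ) :
    ENNReal.ofReal (spectralRadius μ) ≤ phi e μ v := by
  by_cases h : phi e μ v = ⊤
  · rw [h]; exact le_top
  · obtain ⟨κ, hκ⟩ := hasSum_of_phi_ne_top hμ h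
    rw [phi_eq_of_hasSum hμ hκ]
    exact ENNReal.ofReal_le_ofReal (spectralRadius_le_of_hasSum hμ hκ)

/-- Strict convexity of `φ`: the value `λ` is taken at most once. -/
lemma eq_of_phi_eq_spectralRadius (hμ : IsProbability μ) (hnd : IsNondegenerate μ)
    {v w : Fin k → ℝ} (hv : phi e μ v = ENNReal.ofReal (spectralRadius μ))
    (hw : phi e μ w = ENNReal.ofReal (spectralRadius μ)) : v = w := by
  have h0 := spectralRadius_nonneg hμ
  have sv := hasSum_of_phi_eq hμ h0 hv
  have sw := hasSum_of_phi_eq hμ h0 hw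
  set z : Fin k → ℝ := fun i => (v i + w i) / 2 with hz
  have hpz : ∀ g, pairing e z g = pairing e v g / 2 + pairing e w g / 2 := fun g => by
    simp only [pairing, Finset.sum_div, ← Finset.sum_add_distrib]
    exact Finset.sum_congr rfl fun i _ => by rw [hz]; ring
  -- The midpoint convexity defect is a perfect square. Since φ ≥ λ at the midpoint, the total
  -- defect is zero, so v and w pair equally with the support.
  have hsplit : ∀ g, (Real.exp (pairing e v g) * μ g + Real.exp (pairing e w g) * μ g) / 2 -
      Real.exp (pairing e z g) * μ g =
      μ g * (Real.exp (pairing e v g / 2) - Real.exp (pairing e w g / 2)) ^ 2 / 2 := fun g => by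
    have hsq : ∀ x : ℝ, Real.exp x = Real.exp (x / 2) ^ 2 := fun x => by
      rw [← Real.exp_nat_mul]; congr 1; push_cast; ring
    rw [hpz, Real.exp_add, hsq (pairing e v g), hsq (pairing e w g)]
    ring
  have hnn : ∀ g, 0 ≤ μ g * (Real.exp (pairing e v g / 2) - Real.exp (pairing e w g / 2)) ^ 2 / 2 :=
    fun g => by have := hμ.nonneg g; positivity
  have savg := (sv.add sw).div_const 2
  have sz : Summable fun g => Real.exp (pairing e z g) * μ g :=
    savg.summable.of_nonneg_of_le (fun g => mul_nonneg (Real.exp_pos _).le (hμ.nonneg g))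
      fun g => by linarith [hsplit g, hnn g]
  have hle := spectralRadius_le_of_hasSum hμ sz.hasSum
  have hdiff := savg.sub sz.hasSum
  simp only [hsplit] at hdiff
  have hzero : _ = (0 : ℝ) := le_antisymm (by linarith) (hdiff.nonneg hnn)
  rw [hzero, hasSum_zero_iff_of_nonneg hnn] at hdiff
  refine pairing_injective e fun g => ?_
  induction g using hnd.induction with
  | hmem g hg =>
    have h1 := congrFun hdiff g
    simp only [Pi.zero_apply, div_eq_zero_iff, mul_eq_zero, hg.ne', false_or, OfNat.ofNat_ne_zero,
      or_false, ne_eq, not_false_eq_true, pow_eq_zero_iff, sub_eq_zero, Real.exp_eq_exp] at h1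
    linarith
  | hmul g h hg hh => rw [pairing_mul, pairing_mul, hg, hh]

lemma exists_phi_eq_spectralRadius (hG : IsAmenable G) (hμ : IsProbability μ)
    (hnd : IsNondegenerate μ) :
    ∃ v, phi e μ v = ENNReal.ofReal (spectralRadius μ) := by
  obtain ⟨ψ, hψ, hle⟩ := exists_hom_le_spectralRadius hG hμ hnd
  obtain ⟨v, hv⟩ := exists_pairing_eq e hψ
  have hnn : ∀ g, 0 ≤ Real.exp (pairing e v g) * μ g := fun g =>
    mul_nonneg (Real.exp_pos _).le (hμ.nonneg g)
  have hb : ∀ F : Finset G, ∑ g ∈ F, Real.exp (pairing e v g) * μ g ≤ spectralRadius μ :=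
    fun F => by simpa only [hv, mul_comm] using hle F
  have hs := summable_of_sum_le hnn hb
  refine ⟨v, le_antisymm ?_ (spectralRadius_le_phi hμ v)⟩
  rw [phi_eq_of_hasSum hμ hs.hasSum]
  exact ENNReal.ofReal_le_ofReal (hs.tsum_le_of_sum_le hb)

end Tilt

end RatioLimit

/-! ### The ratio limit theorem -/

open RatioLimit in
theorem theorem1p3 {G : Type*} [Group G] (hfg : Group.FG G) (hG : RatioLimit.IsAmenable G)
    (μ : G → ℝ) (hμ : RatioLimit.IsProbability μ) (hnd : RatioLimit.IsNondegenerate μ)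
    (hap : RatioLimit.IsAperiodic μ) {k : ℕ} (e : RatioLimit.Coordinates G k) :
    ∃ ξ : Fin k → ℝ,
      -- `ξ` is the unique minimiser of `φ_μ`
      (∀ v, (∀ w, RatioLimit.phi e μ v ≤ RatioLimit.phi e μ w) ↔ v = ξ) ∧
      -- `ξ` is the unique point at which `φ_μ` takes the value `λ(G, μ)`
      (∀ v, RatioLimit.phi e μ v = ENNReal.ofReal (RatioLimit.spectralRadius μ) ↔ v = ξ) ∧
      (∀ g : G, Tendsto (fun n : ℕ => RatioLimit.convPow μ n g / RatioLimit.convPow μ n 1) atTop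
        (𝓝 (Real.exp (-RatioLimit.pairing e ξ g)))) ∧
      Tendsto (fun n : ℕ => RatioLimit.convPow μ (n + 1) 1 / RatioLimit.convPow μ n 1) atTop
        (𝓝 (RatioLimit.spectralRadius μ)) := by
  obtain ⟨ξ, hξ⟩ := exists_phi_eq_spectralRadius (e := e) hG hμ hnd
  have hval : ∀ v, phi e μ v = ENNReal.ofReal (spectralRadius μ) ↔ v = ξ := fun v =>
    ⟨fun h => eq_of_phi_eq_spectralRadius hμ hnd h hξ, fun h => h ▸ hξ⟩
  have hr := spectralRadius_pos hμ hap
  have hratio := (isCritical_tilt (e := e) hμ hap ξ).tendsto_ratio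
    (isProbability_tilt hμ hr (hasSum_of_phi_eq hμ hr.le hξ)) (isNondegenerate_tilt hnd hr)
    (isAperiodic_tilt hap hr)
  refine ⟨ξ, fun v => ⟨fun h => (hval v).1 ?_, ?_⟩, hval, fun g => ?_, ?_⟩
  · exact le_antisymm (hξ ▸ h ξ) (spectralRadius_le_phi hμ v)
  · rintro rfl w
    exact hξ ▸ spectralRadius_le_phi hμ w
  -- Undoing the tilt: the powers of λ cancel in the ratio, leaving the factor e^{⟨ξ,π(g)⟩}.
  · have h := (hratio g).1.const_mul (Real.exp (-pairing e ξ g))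
    rw [mul_one] at h
    refine h.congr fun n => ?_
    rw [convPow_tilt, convPow_tilt, pairing_one, Real.exp_zero, one_mul,
      div_div_div_cancel_right₀ (pow_pos hr n).ne', mul_div_assoc, ← mul_assoc, ← Real.exp_add,
      neg_add_cancel, Real.exp_zero, one_mul]
  · have h := (hratio 1).2.const_mul (spectralRadius μ)
    rw [mul_one] at h
    refine h.congr fun n => ?_
    rw [convPow_tilt, convPow_tilt, pairing_one, Real.exp_zero, one_mul, one_mul, pow_succ]
    field_simp
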